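/- Let $p\ge 3$ be an integer, $\omega_p=e^{2\pi i/p}$ and $f(z)=\sum_{k=0}^{p-1}\exp(\omega_p^k z)$. Let $V_0=\{x+iy: y=\tan(\pi/p)\,x,\ x>0\}$ and, for $0\le k<p$, let $V_k=\omega_p^kV_0$. Fix $\tau>0$ and let $Q_0=\{z e^{i\pi/p}: \operatorname{Re} z>0,\ |\operatorname{Im} z|<\tau\}$ be the half-infinite strip of width $2\tau$ around $V_0$. For $m\in\mathbb N$ let $C_m$ be the line $y=-\cot(\pi/p)\,x+\frac{m\pi}{\sin^2(\pi/p)}$, which meets $V_0$ perpendicularly at $(m\pi\cot(\pi/p),m\pi)$, and let $D_m\subset Q_0$ be the open rectangle consisting of the points of $Q_0$ strictly between $C_m$ and $C_{m+1}$. Then there is $M\in\mathbb N$ (depending on $p$ and $\tau$) such that for every $m>M$ and every $k\in\{0,\dots,p-1\}$ the rotated rectangle $\omega_p^kD_m$ contains exactly one zero of $f$, and this zero lies on the ray $V_k$. Moreover, these are exactly the zeros of $f$ of modulus larger than $(M+1)\pi/\sin(\pi/p)$. -/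

import Mathlib

noncomputable section

namespace ExpSum

/-- The primitive `p`-th root of unity `ω_p = exp (2πi/p)`. -/
def omega (p : ℕ) : ℂ := Complex.exp (2 * Real.pi * Complex.I / p)

/-- The entire function `f(z) = ∑_{k=0}^{p-1} exp (ω_p ^ k z)`. -/
def f (p : ℕ) (z : ℂ) : ℂ := ∑ k ∈ Finset.range p, Complex.exp (omega p ^ k * z)

/-- The rotation of a set `S` of complex numbers by the angle `2kπ/p` about the origin. -/
def rotate (p k : ℕ) (S : Set ℂ) : Set ℂ := (fun z => omega p ^ k * z) '' S

/-- The ray `V₀ = {x + iy : y = tan (π/p) x, x > 0}`. -/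
def V₀ (p : ℕ) : Set ℂ := {z | z.im = Real.tan (Real.pi / p) * z.re ∧ 0 < z.re}

/-- The ray `V_k`, the rotation of `V₀` by `2kπ/p`. -/
def V (p k : ℕ) : Set ℂ := rotate p k (V₀ p)

/-- The half-infinite strip
`Q_k = {z exp ((2k+1)iπ/p) : Re z > 0, |Im z| < τ}` of width `2τ` around `V_k`. -/
def Q (p : ℕ) (τ : ℝ) (k : ℕ) : Set ℂ :=
  (fun z => z * Complex.exp ((2 * k + 1) * Complex.I * Real.pi / p)) ''
    {z : ℂ | 0 < z.re ∧ |z.im| < τ}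

/-- The (open) rectangle `D_m ⊆ Q₀`: the part of the strip `Q₀` strictly between the lines
`C_m` and `C_{m+1}`, where `C_m = {x + iy : y = -cot (π/p) x + mπ / sin² (π/p)}`. -/
def D (p : ℕ) (τ : ℝ) (m : ℕ) : Set ℂ :=
  {z | z ∈ Q p τ 0 ∧
    -Real.cot (Real.pi / p) * z.re + m * Real.pi / Real.sin (Real.pi / p) ^ 2 < z.im ∧
    z.im < -Real.cot (Real.pi / p) * z.re + (m + 1) * Real.pi / Real.sin (Real.pi / p) ^ 2}

end ExpSum

end

namespace ExpSum

open Complex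

/-! With `w = z exp (-iπ/p)`, `s = sin (π/p)` and `c = cos (π/p)`, the two dominant exponentials
near the positive axis add up to `2 exp (c w) cos (s w)`; the others, divided by `exp (c w)`, form
`tail`, exponentially small far out in the strip (`axialSum_eq`, `norm_tail_le`). Zeros there solve
`2 cos (s w) = -tail p w`. No argument principle is needed: the cosine separates points faster than
`tail` does, so a rectangle holds at most one zero (`eq_of_axialSum_eq_zero`); conjugation symmetry
makes it real; a sign change on the axis produces it (`exists_axialSum_eq_zero`). In the rest of the
sector `|arg w| ≤ π/p` a single exponential dominates far out, so there are no other large zeros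
(`abs_im_lt_of_axialSum_eq_zero`). Invariance under rotation by `ω_p` covers the other sectors. -/

/-- The function `f` in the coordinate `w = z exp (-iπ/p)`, which turns `V₀` into the positive
real axis. -/
noncomputable def axialSum (p : ℕ) (w : ℂ) : ℂ :=
  ∑ k ∈ Finset.range p, exp (exp (((2 * k + 1) * (Real.pi / p) : ℝ) * I) * w)

/-- The terms of `axialSum` other than the two dominant ones, divided by
`exp (w cos (π/p))`. -/
noncomputable def tail (p : ℕ) (w : ℂ) : ℂ :=
  ∑ k ∈ Finset.Ico 1 (p - 1),
    exp ((exp (((2 * k + 1) * (Real.pi / p) : ℝ) * I) - (Real.cos (Real.pi / p) : ℝ)) * w)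

/-- The rectangle `D_m` in the coordinate `w`. -/
def axialRect (p : ℕ) (τ : ℝ) (m : ℕ) : Set ℂ :=
  {w | m * Real.pi / Real.sin (Real.pi / p) < w.re ∧
    w.re < (m + 1) * Real.pi / Real.sin (Real.pi / p) ∧ |w.im| < τ}

variable {p : ℕ} {τ : ℝ}

lemma pi_div_pos (hp : 3 ≤ p) : 0 < Real.pi / p := by
  have : (0 : ℝ) < p := by exact_mod_cast (by omega : 0 < p)
  exact div_pos Real.pi_pos this

lemma pi_div_le (hp : 3 ≤ p) : Real.pi / p ≤ Real.pi / 3 := by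
  have : (3 : ℝ) ≤ p := by exact_mod_cast hp
  exact div_le_div_of_nonneg_left Real.pi_pos.le (by norm_num) this

lemma sin_pi_div_pos (hp : 3 ≤ p) : 0 < Real.sin (Real.pi / p) :=
  Real.sin_pos_of_pos_of_lt_pi (pi_div_pos hp)
    (by linarith [pi_div_le hp, Real.pi_pos])

lemma cos_pi_div_pos (hp : 3 ≤ p) : 0 < Real.cos (Real.pi / p) :=
  Real.cos_pos_of_mem_Ioo
    ⟨by linarith [pi_div_pos hp, Real.pi_pos], by linarith [pi_div_le hp, Real.pi_pos]⟩

lemma natCast_mul_pi_div (hp : 3 ≤ p) : (p : ℝ) * (Real.pi / p) = Real.pi := by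
  have : (p : ℝ) ≠ 0 := by exact_mod_cast (by omega : p ≠ 0)
  field_simp

/-! ### Rotation and conjugation symmetries. -/

lemma omega_eq : omega p = exp ((2 * (Real.pi / p) : ℝ) * I) := by
  rw [omega]
  congr 1
  push_cast
  ring

lemma omega_pow (k : ℕ) : omega p ^ k = exp ((2 * k * (Real.pi / p) : ℝ) * I) := by
  rw [omega_eq, ← Complex.exp_nat_mul]
  congr 1
  push_cast
  ring

lemma omega_pow_self (hp : 3 ≤ p) : omega p ^ p = 1 := by
  rw [omega_pow, mul_assoc, natCast_mul_pi_div hp]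
  push_cast
  exact Complex.exp_two_pi_mul_I

lemma norm_omega_pow (k : ℕ) : ‖omega p ^ k‖ = 1 := by
  rw [omega_pow, Complex.norm_exp_ofReal_mul_I]

lemma f_omega_mul (hp : 3 ≤ p) (z : ℂ) : f p (omega p * z) = f p z := by
  have h1 := Finset.sum_range_succ (fun k => exp (omega p ^ k * z)) p
  have h2 := Finset.sum_range_succ' (fun k => exp (omega p ^ k * z)) p
  simp only [omega_pow_self hp, pow_zero] at h1 h2
  have h3 : f p (omega p * z) = ∑ k ∈ Finset.range p, exp (omega p ^ (k + 1) * z) :=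
    Finset.sum_congr rfl fun k _ => by rw [pow_succ, mul_assoc]
  rw [h3, f]
  exact add_right_cancel (h2.symm.trans h1)

lemma f_omega_pow_mul (hp : 3 ≤ p) (k : ℕ) (z : ℂ) : f p (omega p ^ k * z) = f p z := by
  induction k with
  | zero => simp
  | succ k ih => rw [pow_succ', mul_assoc, f_omega_mul hp, ih]

lemma f_eq_axialSum (hp : 3 ≤ p) (k : ℕ) (w : ℂ) :
    f p (omega p ^ k * (exp ((Real.pi / p : ℝ) * I) * w)) = axialSum p w := by
  rw [f_omega_pow_mul hp, f, axialSum]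
  refine Finset.sum_congr rfl fun j _ => ?_
  rw [omega_pow, ← mul_assoc, ← Complex.exp_add]
  congr 3
  push_cast
  ring

lemma conj_expI_mul (x : ℝ) (w : ℂ) :
    (starRingEnd ℂ) (exp (exp (x * I) * w)) = exp (exp (-x * I) * (starRingEnd ℂ) w) := by
  rw [← Complex.exp_conj, map_mul, ← Complex.exp_conj]
  simp

/-- The index reversal `k ↦ p - 1 - k` takes the angle `(2k+1)π/p` to its negative modulo `2π`. -/
lemma axialSum_conj (hp : 3 ≤ p) (w : ℂ) :
    axialSum p ((starRingEnd ℂ) w) = (starRingEnd ℂ) (axialSum p w) := by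
  rw [axialSum, axialSum, map_sum, ← Finset.sum_range_reflect]
  refine Finset.sum_congr rfl fun k hk => ?_
  have hk' := Finset.mem_range.1 hk
  rw [conj_expI_mul]
  have hc : ((p - 1 - k : ℕ) : ℝ) = p - 1 - k := by
    rw [Nat.cast_sub (by omega), Nat.cast_sub (by omega)]
    simp
  have h2 : (2 * ((p - 1 - k : ℕ) : ℝ) + 1) * (Real.pi / p)
      = 2 * Real.pi - (2 * k + 1) * (Real.pi / p) := by
    rw [hc]
    linear_combination 2 * natCast_mul_pi_div hp
  rw [h2]
  have h3 : (((2 * Real.pi - (2 * k + 1) * (Real.pi / p) : ℝ) : ℂ) * I)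
      = -(((2 * k + 1) * (Real.pi / p) : ℝ) : ℂ) * I + 2 * Real.pi * I := by
    push_cast
    ring
  rw [h3, Complex.exp_periodic]

/-! ### Dominant terms and decay of the tail. -/

lemma sum_range_eq_first_add_Ico_add_last (hp : 3 ≤ p) (F : ℕ → ℂ) :
    ∑ k ∈ Finset.range p, F k = F 0 + ∑ k ∈ Finset.Ico 1 (p - 1), F k + F (p - 1) := by
  obtain ⟨q, rfl⟩ : ∃ q, p = q + 2 := ⟨p - 2, by omega⟩
  rw [Finset.sum_range_succ, Finset.range_eq_Ico, Finset.sum_eq_sum_Ico_succ_bot (by omega)]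
  rfl

lemma axialSum_eq (hp : 3 ≤ p) (w : ℂ) :
    axialSum p w = exp ((Real.cos (Real.pi / p) : ℝ) * w) *
      (2 * Complex.cos ((Real.sin (Real.pi / p) : ℝ) * w) + tail p w) := by
  set F : ℕ → ℂ := fun k => exp (exp (((2 * k + 1) * (Real.pi / p) : ℝ) * I) * w) with hF
  have hsum : axialSum p w = F 0 + ∑ k ∈ Finset.Ico 1 (p - 1), F k + F (p - 1) :=
    sum_range_eq_first_add_Ico_add_last hp F
  have h0 : F 0 = exp ((Real.cos (Real.pi / p) : ℝ) * w) *
      exp ((Real.sin (Real.pi / p) : ℝ) * w * I) := by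
    rw [← Complex.exp_add, hF]
    simp only [Nat.cast_zero, mul_zero, zero_add, one_mul]
    rw [Complex.exp_mul_I, ← Complex.ofReal_cos, ← Complex.ofReal_sin]
    congr 1
    ring
  have h1 : F (p - 1) = exp ((Real.cos (Real.pi / p) : ℝ) * w) *
      exp (-((Real.sin (Real.pi / p) : ℝ) * w) * I) := by
    rw [← Complex.exp_add, hF]
    have hc : ((p - 1 : ℕ) : ℝ) = p - 1 := by
      rw [Nat.cast_sub (by omega)]
      simp
    have h2 : (2 * ((p - 1 : ℕ) : ℝ) + 1) * (Real.pi / p) = 2 * Real.pi - Real.pi / p := by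
      rw [hc]
      linear_combination 2 * natCast_mul_pi_div hp
    simp only [h2]
    rw [Complex.exp_mul_I, ← Complex.ofReal_cos, ← Complex.ofReal_sin, Real.cos_two_pi_sub,
      Real.sin_two_pi_sub]
    congr 1
    push_cast
    ring
  have h2 : ∑ k ∈ Finset.Ico 1 (p - 1), F k
      = exp ((Real.cos (Real.pi / p) : ℝ) * w) * tail p w := by
    rw [tail, Finset.mul_sum]
    refine Finset.sum_congr rfl fun k _ => ?_
    rw [← Complex.exp_add]
    simp only [hF]
    congr 1
    ring
  rw [hsum, h0, h1, h2, Complex.two_cos]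
  ring

lemma axialSum_eq_zero_iff (hp : 3 ≤ p) (w : ℂ) :
    axialSum p w = 0 ↔ 2 * Complex.cos ((Real.sin (Real.pi / p) : ℝ) * w) = -tail p w := by
  rw [axialSum_eq hp, mul_eq_zero, or_iff_right (Complex.exp_ne_zero _), add_eq_zero_iff_eq_neg]

lemma sin_pi_div_le_sin (hp : 3 ≤ p) {x : ℝ} (h1 : Real.pi / p ≤ x)
    (h2 : x ≤ Real.pi - Real.pi / p) : Real.sin (Real.pi / p) ≤ Real.sin x := by
  have ha := pi_div_pos hp
  have ha' := pi_div_le hp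
  have hpi := Real.pi_pos
  rcases le_total x (Real.pi / 2) with h | h
  · exact Real.sin_le_sin_of_le_of_le_pi_div_two (by linarith) h h1
  · rw [← Real.sin_pi_sub x]
    exact Real.sin_le_sin_of_le_of_le_pi_div_two (by linarith) (by linarith) (by linarith)

/-- The difference of cosines is twice a product of two sines of angles in `[π/p, π - π/p]`. With `φ
= 0` this gives the decay of `tail`; general `φ` serves the estimate off the strip. -/
lemma cos_add_le (hp : 3 ≤ p) {φ : ℝ} (h0 : 0 ≤ φ) (h1 : φ ≤ Real.pi / p) {k : ℕ}
    (hk : k ∈ Finset.Ico 1 (p - 1)) :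
    Real.cos (φ + (2 * k + 1) * (Real.pi / p)) ≤
      Real.cos (φ - Real.pi / p) - 2 * Real.sin (Real.pi / p) ^ 2 := by
  obtain ⟨hk1, hk2⟩ := Finset.mem_Ico.1 hk
  have ha := pi_div_pos hp
  have hpa := natCast_mul_pi_div hp
  have hk1' : (1 : ℝ) ≤ k := by exact_mod_cast hk1
  have hk2' : (k : ℝ) + 2 ≤ p := by exact_mod_cast (by omega : k + 2 ≤ p)
  have e1 := mul_le_mul_of_nonneg_right hk1' ha.le
  have e2 := mul_le_mul_of_nonneg_right hk2' ha.le
  have s1 := sin_pi_div_le_sin hp (x := φ + k * (Real.pi / p)) (by linarith) (by linarith)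
  have s2 := sin_pi_div_le_sin hp (x := (k + 1) * (Real.pi / p)) (by linarith) (by linarith)
  have hs := sin_pi_div_pos hp
  have key : Real.cos (φ - Real.pi / p) - Real.cos (φ + (2 * k + 1) * (Real.pi / p))
      = 2 * Real.sin (φ + k * (Real.pi / p)) * Real.sin ((k + 1) * (Real.pi / p)) := by
    rw [show φ - Real.pi / p = (φ + k * (Real.pi / p)) - (k + 1) * (Real.pi / p) by ring,
      show φ + (2 * k + 1) * (Real.pi / p) = (φ + k * (Real.pi / p)) + (k + 1) * (Real.pi / p)
        by ring, Real.cos_sub (φ + k * (Real.pi / p)),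
      Real.cos_add (φ + k * (Real.pi / p))]
    ring
  nlinarith [mul_le_mul s1 s2 hs.le (by linarith)]

lemma norm_exp_tail_le (hp : 3 ≤ p) {k : ℕ} (hk : k ∈ Finset.Ico 1 (p - 1)) {S : ℝ} (hS : 0 ≤ S)
    {w : ℂ} (hw : S ≤ w.re) (ht : |w.im| ≤ τ) :
    ‖exp ((exp (((2 * k + 1) * (Real.pi / p) : ℝ) * I) - (Real.cos (Real.pi / p) : ℝ)) * w)‖ ≤
      Real.exp (τ - 2 * Real.sin (Real.pi / p) ^ 2 * S) := by
  rw [Complex.norm_exp, Complex.mul_re, Complex.sub_re, Complex.sub_im, Complex.exp_ofReal_mul_I_re,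
    Complex.exp_ofReal_mul_I_im, Complex.ofReal_re, Complex.ofReal_im, sub_zero]
  refine Real.exp_le_exp.2 ?_
  have hc := cos_add_le hp le_rfl (pi_div_pos hp).le hk
  rw [zero_add, zero_sub, Real.cos_neg] at hc
  set θ := (2 * (k : ℝ) + 1) * (Real.pi / p)
  have h1 : -(Real.sin θ * w.im) ≤ τ := by
    refine (neg_le_abs _).trans ?_
    rw [abs_mul]
    exact (mul_le_of_le_one_left (abs_nonneg _) (Real.abs_sin_le_one _)).trans ht
  have h2 : (Real.cos θ - Real.cos (Real.pi / p)) * w.re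
      ≤ -(2 * Real.sin (Real.pi / p) ^ 2) * w.re :=
    mul_le_mul_of_nonneg_right (by linarith) (hS.trans hw)
  have h3 := mul_le_mul_of_nonneg_left hw (by positivity : 0 ≤ 2 * Real.sin (Real.pi / p) ^ 2)
  linarith

/-- A bound for `tail p`, and for half of its Lipschitz constant, on the part of a strip to the
right of `S`. -/
noncomputable def tailBound (p : ℕ) (τ S : ℝ) : ℝ :=
  p * Real.exp (τ - 2 * Real.sin (Real.pi / p) ^ 2 * S)

lemma norm_tail_le (hp : 3 ≤ p) {S : ℝ} (hS : 0 ≤ S) {w : ℂ} (hw : S ≤ w.re) (ht : |w.im| ≤ τ) :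
    ‖tail p w‖ ≤ tailBound p τ S := by
  refine (norm_sum_le_of_le _ fun k hk => norm_exp_tail_le hp hk hS hw ht).trans ?_
  rw [Finset.sum_const, Nat.card_Ico, nsmul_eq_mul, tailBound]
  gcongr
  omega

lemma norm_coeff_le (x y : ℝ) : ‖exp (x * I) - (Real.cos y : ℝ)‖ ≤ 2 := by
  refine (norm_sub_le _ _).trans ?_
  rw [Complex.norm_exp_ofReal_mul_I, Complex.norm_real, Real.norm_eq_abs]
  linarith [Real.abs_cos_le_one y]

lemma hasDerivAt_tail (p : ℕ) (w : ℂ) :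
    HasDerivAt (tail p) (∑ k ∈ Finset.Ico 1 (p - 1),
      exp ((exp (((2 * k + 1) * (Real.pi / p) : ℝ) * I) - (Real.cos (Real.pi / p) : ℝ)) * w) *
        (exp (((2 * k + 1) * (Real.pi / p) : ℝ) * I) - (Real.cos (Real.pi / p) : ℝ))) w := by
  refine HasDerivAt.fun_sum fun k _ => ?_
  exact (hasDerivAt_const_mul _).cexp

lemma continuous_tail (p : ℕ) : Continuous (tail p) :=
  continuous_iff_continuousAt.2 fun w => (hasDerivAt_tail p w).continuousAt

lemma norm_tail_sub_tail_le (hp : 3 ≤ p) {S : ℝ} (hS : 0 ≤ S) {w₁ w₂ : ℂ}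
    (hw₁ : S ≤ w₁.re) (ht₁ : |w₁.im| ≤ τ) (hw₂ : S ≤ w₂.re) (ht₂ : |w₂.im| ≤ τ) :
    ‖tail p w₁ - tail p w₂‖ ≤ 2 * tailBound p τ S * ‖w₁ - w₂‖ := by
  have hconv : Convex ℝ {w : ℂ | S ≤ w.re ∧ |w.im| ≤ τ} := by
    have h1 : Convex ℝ {w : ℂ | S ≤ w.re} := convex_halfSpace_re_ge S
    have h2 : Convex ℝ {w : ℂ | w.im ≤ τ} := convex_halfSpace_im_le τ
    have h3 : Convex ℝ {w : ℂ | -τ ≤ w.im} := convex_halfSpace_im_ge (-τ)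
    convert h1.inter (h3.inter h2) using 1
    ext w
    simp [abs_le]
  refine hconv.norm_image_sub_le_of_norm_hasDerivWithin_le
    (fun w _ => (hasDerivAt_tail p w).hasDerivWithinAt) (fun w hw => ?_) ⟨hw₂, ht₂⟩ ⟨hw₁, ht₁⟩
  refine (norm_sum_le_of_le _ fun k hk => (norm_mul_le _ _).trans
    (mul_le_mul (norm_exp_tail_le hp hk hS hw.1 hw.2) (norm_coeff_le _ _) (norm_nonneg _)
      (Real.exp_nonneg _))).trans ?_
  rw [Finset.sum_const, Nat.card_Ico, nsmul_eq_mul, tailBound, mul_comm (2 : ℝ) (_ * Real.exp _), mul_assoc (p : ℝ)]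
  gcongr
  omega

/-! ### Lower bounds for the complex sine. -/

lemma norm_sin_add_mul_I_sq (x y : ℝ) :
    ‖Complex.sin (x + y * I)‖ ^ 2 = Real.sin x ^ 2 + Real.sinh y ^ 2 := by
  rw [Complex.sin_add_mul_I, ← Complex.ofReal_sin, ← Complex.ofReal_cosh, ← Complex.ofReal_cos,
    ← Complex.ofReal_sinh, ← Complex.ofReal_mul, ← Complex.ofReal_mul, ← Complex.normSq_eq_norm_sq,
    Complex.normSq_add_mul_I]
  nlinarith [Real.cosh_sq y, Real.sin_sq_add_cos_sq x]

lemma sq_le_sinh_sq (y : ℝ) : y ^ 2 ≤ Real.sinh y ^ 2 := by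
  rw [sq_le_sq, Real.abs_sinh]
  exact Real.self_le_sinh_iff.2 (abs_nonneg y)

lemma abs_sin_re_le (u : ℂ) : |Real.sin u.re| ≤ ‖Complex.sin u‖ := by
  refine abs_le_of_sq_le_sq ?_ (norm_nonneg _)
  have h := norm_sin_add_mul_I_sq u.re u.im
  rw [Complex.re_add_im] at h
  nlinarith [sq_nonneg (Real.sinh u.im)]

lemma abs_cos_re_le (u : ℂ) : |Real.cos u.re| ≤ ‖Complex.cos u‖ := by
  have h := abs_sin_re_le (u + (Real.pi / 2 : ℝ))
  rw [Complex.add_re, Complex.ofReal_re, Real.sin_add_pi_div_two] at h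
  push_cast at h
  rwa [Complex.sin_add_pi_div_two] at h

/-- Jordan's inequality in a vertical strip. -/
lemma two_div_pi_mul_norm_le_norm_sin {u : ℂ} (hu : |u.re| ≤ Real.pi / 2) :
    2 / Real.pi * ‖u‖ ≤ ‖Complex.sin u‖ := by
  refine abs_le_of_sq_le_sq' ?_ (norm_nonneg _) |>.2
  have h := norm_sin_add_mul_I_sq u.re u.im
  rw [Complex.re_add_im] at h
  rw [mul_pow, h, ← Complex.normSq_eq_norm_sq, Complex.normSq_apply]
  have h1 : (2 / Real.pi) ^ 2 * u.re ^ 2 ≤ Real.sin u.re ^ 2 := by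
    rw [← mul_pow, ← sq_abs (Real.sin _), ← sq_abs (_ * _), abs_mul,
      abs_of_pos (by positivity : 0 < 2 / Real.pi)]
    exact pow_le_pow_left₀ (by positivity) (Real.mul_abs_le_abs_sin hu) 2
  have h2 : (2 / Real.pi) ^ 2 ≤ 1 := by
    refine pow_le_one₀ (by positivity) ?_
    rw [div_le_one Real.pi_pos]
    linarith [Real.pi_gt_three]
  have h3 := mul_le_of_le_one_left (sq_nonneg u.im) h2
  linarith [sq_le_sinh_sq u.im]

/-- Factor `sin u - sin v = 2 sin ((u-v)/2) cos ((u+v)/2)`: Jordan bounds the sine below, and small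
sines keep the real parts in `[-1, 1]`, where the cosine is at least `1/2`. -/
lemma norm_sub_le_of_norm_sin_le {u v : ℂ} (hu : |u.re| ≤ Real.pi / 2) (hv : |v.re| ≤ Real.pi / 2)
    (hsu : ‖Complex.sin u‖ ≤ 1 / 2) (hsv : ‖Complex.sin v‖ ≤ 1 / 2) :
    ‖u - v‖ ≤ Real.pi * ‖Complex.sin u - Complex.sin v‖ := by
  have hre : ∀ x : ℂ, |x.re| ≤ Real.pi / 2 → ‖Complex.sin x‖ ≤ 1 / 2 → |x.re| ≤ 1 := by
    intro x hx hsx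
    have h1 := (Real.mul_abs_le_abs_sin hx).trans ((abs_sin_re_le x).trans hsx)
    rw [div_mul_eq_mul_div, div_le_iff₀ Real.pi_pos] at h1
    linarith [Real.pi_lt_four]
  have hu1 := abs_le.1 (hre u hu hsu)
  have hv1 := abs_le.1 (hre v hv hsv)
  have hu2 := abs_le.1 hu
  have hv2 := abs_le.1 hv
  have hdiv : ∀ z : ℂ, (z / 2).re = z.re / 2 := fun z => by simp
  have hd := two_div_pi_mul_norm_le_norm_sin (u := (u - v) / 2) (by
    rw [hdiv, Complex.sub_re, abs_le]
    constructor <;> linarith)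
  have hc := abs_cos_re_le ((u + v) / 2)
  have hc1 : 1 / 2 ≤ Real.cos ((u + v) / 2).re := by
    refine le_trans ?_ (Real.one_sub_sq_div_two_le_cos)
    rw [hdiv, Complex.add_re]
    have : ((u.re + v.re) / 2) ^ 2 ≤ 1 := by
      rw [sq_le_one_iff_abs_le_one, abs_le]
      constructor <;> linarith
    linarith
  have hc2 := (hc1.trans (le_abs_self _)).trans hc
  rw [Complex.sin_sub_sin, norm_mul, norm_mul, Complex.norm_two]
  rw [norm_div, Complex.norm_two, div_mul_eq_mul_div, div_le_iff₀ Real.pi_pos] at hd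
  have := mul_le_mul hd hc2 (by norm_num) (by positivity)
  linarith

lemma sin_sub_nat_add_half_mul_pi (z : ℂ) (m : ℕ) :
    Complex.sin (z - ((m + 1 / 2) * Real.pi : ℝ)) = -((-1) ^ m * Complex.cos z) := by
  have h := Complex.cos_antiperiodic.add_nat_mul_eq
    (x := z - ((m + 1 / 2) * Real.pi : ℝ) + Real.pi / 2) m
  rw [Complex.cos_add_pi_div_two] at h
  have e : z - ((m + 1 / 2) * Real.pi : ℝ) + Real.pi / 2 + m * Real.pi = z := by
    push_cast
    ring
  rw [e] at h
  rw [h, mul_neg, mul_neg, neg_neg, ← mul_assoc, ← mul_pow]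
  simp

/-! ### Zeros inside the rectangles. -/

lemma abs_sin_mul_re_sub_le (hp : 3 ≤ p) {m : ℕ} {w : ℂ} (hw : w ∈ axialRect p τ m) :
    |((Real.sin (Real.pi / p) : ℝ) * w - ((m + 1 / 2) * Real.pi : ℝ)).re| ≤ Real.pi / 2 := by
  have hs := sin_pi_div_pos hp
  obtain ⟨h1, h2, -⟩ := hw
  rw [div_lt_iff₀ hs] at h1
  rw [lt_div_iff₀ hs] at h2
  rw [Complex.sub_re, Complex.re_ofReal_mul, Complex.ofReal_re, abs_le]
  constructor <;> linarith

lemma eq_of_axialSum_eq_zero (hp : 3 ≤ p) {S : ℝ} (hS : 0 ≤ S)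
    (hε : tailBound p τ S ≤ Real.sin (Real.pi / p) / 8) {m : ℕ} {w₁ w₂ : ℂ}
    (hw₁ : w₁ ∈ axialRect p τ m) (hw₂ : w₂ ∈ axialRect p τ m) (hS₁ : S ≤ w₁.re) (hS₂ : S ≤ w₂.re)
    (h₁ : axialSum p w₁ = 0) (h₂ : axialSum p w₂ = 0) : w₁ = w₂ := by
  have hs := sin_pi_div_pos hp
  have key : ∀ w ∈ axialRect p τ m, S ≤ w.re → axialSum p w = 0 →
      ‖Complex.sin ((Real.sin (Real.pi / p) : ℝ) * w - ((m + 1 / 2) * Real.pi : ℝ))‖ ≤ 1 / 2 := by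
    intro w hw hSw h
    have h3 := congrArg norm ((axialSum_eq_zero_iff hp w).1 h)
    rw [norm_mul, Complex.norm_two, norm_neg] at h3
    rw [sin_sub_nat_add_half_mul_pi, norm_neg, norm_mul, norm_pow, norm_neg, norm_one, one_pow,
      one_mul]
    linarith [norm_tail_le hp hS hSw hw.2.2.le, Real.sin_le_one (Real.pi / p)]
  have h3 := norm_sub_le_of_norm_sin_le (abs_sin_mul_re_sub_le hp hw₁)
    (abs_sin_mul_re_sub_le hp hw₂) (key w₁ hw₁ hS₁ h₁) (key w₂ hw₂ hS₂ h₂)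
  rw [sub_sub_sub_cancel_right, ← mul_sub, norm_mul, Complex.norm_real, Real.norm_eq_abs,
    abs_of_pos hs, sin_sub_nat_add_half_mul_pi, sin_sub_nat_add_half_mul_pi,
    neg_sub_neg, ← mul_sub, norm_mul, norm_pow, norm_neg, norm_one, one_pow, one_mul] at h3
  have h4 : 2 * ‖Complex.cos ((Real.sin (Real.pi / p) : ℝ) * w₂) -
      Complex.cos ((Real.sin (Real.pi / p) : ℝ) * w₁)‖ = ‖tail p w₁ - tail p w₂‖ := by
    rw [← Complex.norm_two, ← norm_mul, mul_sub, (axialSum_eq_zero_iff hp _).1 h₁,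
      (axialSum_eq_zero_iff hp _).1 h₂, neg_sub_neg]
  have h5 := norm_tail_sub_tail_le hp hS hS₁ hw₁.2.2.le hS₂ hw₂.2.2.le
  by_contra hne
  have hpos : 0 < ‖w₁ - w₂‖ := norm_pos_iff.2 (sub_ne_zero.2 hne)
  have h6 := mul_le_mul_of_nonneg_right hε hpos.le
  have h7 := mul_pos hs hpos
  have h8 : Real.pi * ‖Complex.cos ((Real.sin (Real.pi / p) : ℝ) * w₂) -
      Complex.cos ((Real.sin (Real.pi / p) : ℝ) * w₁)‖ ≤
      -- The `8` in `hε` makes this `s ‖w₁ - w₂‖ / 2`, whereas `h3` bounds the left side below by `s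
      -- ‖w₁ - w₂‖`.
      4 * (Real.sin (Real.pi / p) / 8 * ‖w₁ - w₂‖) :=
    mul_le_mul Real.pi_le_four (by linarith) (norm_nonneg _) (by norm_num)
  linarith

/-- The conjugate is a zero in the same rectangle, so uniqueness makes it equal to `w`. -/
lemma im_eq_zero_of_axialSum_eq_zero (hp : 3 ≤ p) {S : ℝ} (hS : 0 ≤ S)
    (hε : tailBound p τ S ≤ Real.sin (Real.pi / p) / 8) {m : ℕ} {w : ℂ}
    (hw : w ∈ axialRect p τ m) (hSw : S ≤ w.re) (h : axialSum p w = 0) : w.im = 0 := by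
  refine Complex.conj_eq_iff_im.1 (eq_of_axialSum_eq_zero hp hS hε ?_ hw ?_ hSw ?_ h)
  · exact ⟨hw.1, hw.2.1, by simpa using hw.2.2⟩
  · simpa using hSw
  · rw [axialSum_conj hp, h, map_zero]

lemma exists_axialSum_eq_zero (hp : 3 ≤ p) (hτ : 0 < τ) {S : ℝ} (hS : 0 ≤ S)
    (hε : tailBound p τ S ≤ Real.sin (Real.pi / p) / 8) {m : ℕ}
    (hm : S ≤ m * Real.pi / Real.sin (Real.pi / p)) : ∃ w ∈ axialRect p τ m, axialSum p w = 0 := by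
  have hs := sin_pi_div_pos hp
  have hs1 := Real.sin_le_one (Real.pi / p)
  have hab : m * Real.pi / Real.sin (Real.pi / p) ≤ (m + 1) * Real.pi / Real.sin (Real.pi / p) := by
    gcongr
    linarith
  -- At the ends of the interval `2 cos` is `±2` with opposite signs, and the tail is at most `1` in
  -- modulus. Only the real part needs treatment, since `axialSum` is real on the axis.
  set ψ : ℝ → ℝ := fun s =>
    (-1) ^ m * (2 * Real.cos (Real.sin (Real.pi / p) * s) + (tail p s).re) with hψ
  have hcont : Continuous ψ := by
    have := continuous_tail p
    fun_prop
  have htail : ∀ s : ℝ, S ≤ s → |(-1) ^ m * (tail p s).re| ≤ 1 := by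
    intro s hs'
    rw [abs_mul, abs_pow, abs_neg, abs_one, one_pow, one_mul]
    have := norm_tail_le hp hS (w := s) (τ := τ) (by simpa using hs') (by simpa using hτ.le)
    linarith [Complex.abs_re_le_norm (tail p s)]
  have h0 : 0 < ψ (m * Real.pi / Real.sin (Real.pi / p)) := by
    have := abs_le.1 (htail _ hm)
    simp only [hψ]
    rw [mul_div_cancel₀ _ hs.ne', Real.cos_nat_mul_pi, mul_add, mul_left_comm, ← mul_pow,
      neg_one_mul, neg_neg, one_pow]
    linarith
  have h1 : ψ ((m + 1) * Real.pi / Real.sin (Real.pi / p)) < 0 := by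
    have := abs_le.1 (htail _ (hm.trans hab))
    simp only [hψ]
    rw [mul_div_cancel₀ _ hs.ne', add_one_mul (m : ℝ), Real.cos_add_pi, Real.cos_nat_mul_pi,
      mul_add ((-1) ^ m : ℝ), mul_left_comm, mul_neg, ← mul_pow, neg_one_mul, neg_neg, one_pow,
      ← add_one_mul (m : ℝ)]
    linarith
  obtain ⟨s, ⟨hs2, hs3⟩, hs4⟩ := intermediate_value_Ioo' hab hcont.continuousOn ⟨h1, h0⟩
  have hs5 : 2 * Real.cos (Real.sin (Real.pi / p) * s) + (tail p s).re = 0 :=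
    (mul_eq_zero.1 hs4).resolve_left (pow_ne_zero _ (by norm_num))
  refine ⟨s, ⟨by simpa using hs2, by simpa using hs3, by simpa using hτ⟩, Complex.ext ?_ ?_⟩
  · rw [axialSum_eq hp, ← Complex.ofReal_mul, ← Complex.ofReal_mul, ← Complex.ofReal_exp,
      ← Complex.ofReal_cos, Complex.re_ofReal_mul, Complex.add_re, Complex.re_mul_ofReal]
    simp only [Complex.re_ofNat]
    rw [hs5, mul_zero, Complex.zero_re]
  · have := axialSum_conj hp s
    rw [Complex.conj_ofReal, eq_comm, Complex.conj_eq_iff_im] at this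
    simpa using this

lemma exists_mem_axialRect (hp : 3 ≤ p) {S : ℝ} (hS : 0 ≤ S)
    (hε : tailBound p τ S ≤ Real.sin (Real.pi / p) / 8) {w : ℂ} (hSw : S ≤ w.re)
    (ht : |w.im| < τ) (h : axialSum p w = 0) : ∃ m : ℕ, w ∈ axialRect p τ m := by
  have hs := sin_pi_div_pos hp
  have hpos : 0 ≤ Real.sin (Real.pi / p) * w.re / Real.pi :=
    div_nonneg (mul_nonneg hs.le (hS.trans hSw)) Real.pi_pos.le
  set m := ⌊Real.sin (Real.pi / p) * w.re / Real.pi⌋₊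
  have h1 := Nat.floor_le hpos
  have h2 := Nat.lt_floor_add_one (Real.sin (Real.pi / p) * w.re / Real.pi)
  rw [le_div_iff₀ Real.pi_pos] at h1
  rw [div_lt_iff₀ Real.pi_pos] at h2
  refine ⟨m, ?_, ?_, ht⟩
  · rw [div_lt_iff₀ hs, mul_comm w.re]
    -- No zero lies on a dividing line: there `‖cos (s w)‖ ≥ 1`, too large for the tail.
    refine lt_of_le_of_ne h1 fun he => ?_
    have h3 := abs_cos_re_le ((Real.sin (Real.pi / p) : ℝ) * w)
    rw [Complex.re_ofReal_mul, ← he, Real.cos_nat_mul_pi, abs_pow, abs_neg, abs_one, one_pow] at h3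
    have h4 := congrArg norm ((axialSum_eq_zero_iff hp w).1 h)
    rw [norm_mul, Complex.norm_two, norm_neg] at h4
    linarith [norm_tail_le hp hS hSw ht.le, Real.sin_le_one (Real.pi / p)]
  · rwa [lt_div_iff₀ hs, mul_comm w.re]

/-! ### Large zeros lie in the strips. -/

lemma norm_exp_rotated (θ φ r : ℝ) :
    ‖exp (exp (θ * I) * (r * exp (φ * I)))‖ = Real.exp (r * Real.cos (φ + θ)) := by
  rw [Complex.norm_exp, mul_left_comm, ← Complex.exp_add, Complex.re_ofReal_mul, ← add_mul,
    ← Complex.ofReal_add, Complex.exp_ofReal_mul_I_re, add_comm]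

/-- At a zero in the half-sector `0 ≤ arg w ≤ π/p`, the largest term is balanced by the others. -/
lemma one_le_of_axialSum_eq_zero (hp : 3 ≤ p) {r φ : ℝ} (hr : 0 ≤ r) (h0 : 0 ≤ φ)
    (h1 : φ ≤ Real.pi / p) (h : axialSum p (r * exp (φ * I)) = 0) :
    1 ≤ Real.exp (-(2 * Real.sin (Real.pi / p) * (r * Real.sin φ))) +
      p * Real.exp (-(2 * Real.sin (Real.pi / p) ^ 2 * r)) := by
  set F : ℕ → ℂ := fun k => exp (exp (((2 * k + 1) * (Real.pi / p) : ℝ) * I) *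
    (r * exp (φ * I))) with hF
  have hnorm : ∀ k, ‖F k‖ = Real.exp (r * Real.cos (φ + (2 * k + 1) * (Real.pi / p))) :=
    fun k => norm_exp_rotated _ _ _
  have hsum : F 0 + ∑ k ∈ Finset.Ico 1 (p - 1), F k = - F (p - 1) := by
    rw [eq_neg_iff_add_eq_zero, ← h]
    exact (sum_range_eq_first_add_Ico_add_last hp F).symm
  -- `exp A` is the modulus of the term `k = p - 1`, the largest when `0 ≤ φ ≤ π/p`.
  set A := r * Real.cos (φ - Real.pi / p) with hA
  have hlast : ‖F (p - 1)‖ = Real.exp A := by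
    have hc : ((p - 1 : ℕ) : ℝ) = p - 1 := by
      rw [Nat.cast_sub (by omega)]
      simp
    have h2 : φ + (2 * ((p - 1 : ℕ) : ℝ) + 1) * (Real.pi / p)
        = φ - Real.pi / p + 2 * Real.pi := by
      rw [hc]
      linear_combination 2 * natCast_mul_pi_div hp
    rw [hnorm, h2, Real.cos_add_two_pi]
  have hfirst : ‖F 0‖ = Real.exp A *
      Real.exp (-(2 * Real.sin (Real.pi / p) * (r * Real.sin φ))) := by
    rw [hnorm, ← Real.exp_add, hA, Real.cos_sub, Nat.cast_zero, mul_zero, zero_add, one_mul,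
      Real.cos_add]
    congr 1
    ring
  have hrest : ‖∑ k ∈ Finset.Ico 1 (p - 1), F k‖ ≤
      Real.exp A * (p * Real.exp (-(2 * Real.sin (Real.pi / p) ^ 2 * r))) := by
    have hk : ∀ k ∈ Finset.Ico 1 (p - 1),
        ‖F k‖ ≤ Real.exp A * Real.exp (-(2 * Real.sin (Real.pi / p) ^ 2 * r)) := by
      intro k hk
      rw [hnorm, ← Real.exp_add, Real.exp_le_exp]
      have := mul_le_mul_of_nonneg_left (cos_add_le hp h0 h1 hk) hr
      rw [hA]
      linarith
    refine (norm_sum_le_of_le _ hk).trans ?_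
    rw [Finset.sum_const, Nat.card_Ico, nsmul_eq_mul, mul_left_comm]
    gcongr
    omega
  have h2 := norm_add_le (F 0) (∑ k ∈ Finset.Ico 1 (p - 1), F k)
  rw [hsum, norm_neg, hlast, hfirst] at h2
  have h3 : Real.exp A * 1 ≤ Real.exp A *
      (Real.exp (-(2 * Real.sin (Real.pi / p) * (r * Real.sin φ))) +
        p * Real.exp (-(2 * Real.sin (Real.pi / p) ^ 2 * r))) := by
    linarith
  exact le_of_mul_le_mul_left h3 (Real.exp_pos A)

lemma abs_im_lt_of_axialSum_eq_zero (hp : 3 ≤ p) {r φ : ℝ} (hr : 0 ≤ r)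
    (hφ : |φ| ≤ Real.pi / p) (h : axialSum p (r * exp (φ * I)) = 0)
    (hR : p * Real.exp (-(2 * Real.sin (Real.pi / p) ^ 2 * r)) <
      1 - Real.exp (-(2 * Real.sin (Real.pi / p) * τ))) : |r * Real.sin φ| < τ := by
  have hs := sin_pi_div_pos hp
  have key : ∀ φ : ℝ, 0 ≤ φ → φ ≤ Real.pi / p → axialSum p (r * exp (φ * I)) = 0 →
      r * Real.sin φ < τ := by
    intro φ h0 h1 h
    by_contra! hcon
    have h2 := one_le_of_axialSum_eq_zero hp hr h0 h1 h
    have h3 : Real.exp (-(2 * Real.sin (Real.pi / p) * (r * Real.sin φ))) ≤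
        Real.exp (-(2 * Real.sin (Real.pi / p) * τ)) := by
      gcongr
    linarith
  have hpi : Real.pi / p ≤ Real.pi := by linarith [pi_div_le hp, Real.pi_pos]
  have habs : |r * Real.sin φ| = r * Real.sin |φ| := by
    rw [abs_mul, abs_of_nonneg hr, Real.abs_sin_eq_sin_abs_of_abs_le_pi (hφ.trans hpi)]
  rw [habs]
  refine key _ (abs_nonneg _) hφ ?_
  -- Conjugation reduces negative `φ` to the upper half-sector.
  rcases abs_choice φ with h' | h' <;> rw [h']
  · exact h
  · have := axialSum_conj hp (r * exp (φ * I))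
    rw [h, map_zero, map_mul, Complex.conj_ofReal, ← Complex.exp_conj, map_mul,
      Complex.conj_ofReal, Complex.conj_I] at this
    rw [← this]
    congr 3
    push_cast
    ring

/-! ### Return to the original coordinate. -/

lemma exists_rotation (hp : 3 ≤ p) (z : ℂ) : ∃ k < p, ∃ φ : ℝ, |φ| ≤ Real.pi / p ∧
    z = omega p ^ k * (exp ((Real.pi / p : ℝ) * I) * (‖z‖ * exp (φ * I))) := by
  have ha := pi_div_pos hp
  have hpa := natCast_mul_pi_div hp
  obtain ⟨β, hβ0, hβ1, hz⟩ : ∃ β : ℝ, 0 ≤ β ∧ β < 2 * Real.pi ∧ z = ‖z‖ * exp (β * I) := by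
    rcases le_or_gt 0 z.arg with h | h
    · exact ⟨z.arg, h, by linarith [Complex.arg_le_pi z, Real.pi_pos],
        (Complex.norm_mul_exp_arg_mul_I z).symm⟩
    · refine ⟨z.arg + 2 * Real.pi, by linarith [Complex.neg_pi_lt_arg z, Real.pi_pos],
        by linarith, ?_⟩
      push_cast
      rw [add_mul, Complex.exp_periodic]
      exact (Complex.norm_mul_exp_arg_mul_I z).symm
  have hpos : 0 ≤ β / (2 * (Real.pi / p)) := by positivity
  have h1 := Nat.floor_le hpos
  have h2 := Nat.lt_floor_add_one (β / (2 * (Real.pi / p)))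
  -- The sector of half-angle `π/p` about `V_k` is `2kπ/p ≤ β ≤ 2(k+1)π/p`.
  set k := ⌊β / (2 * (Real.pi / p))⌋₊
  rw [le_div_iff₀ (by positivity)] at h1
  rw [div_lt_iff₀ (by positivity)] at h2
  refine ⟨k, ?_, β - (2 * k + 1) * (Real.pi / p), ?_, ?_⟩
  · by_contra! hcon
    have hcon' : (p : ℝ) ≤ k := by exact_mod_cast hcon
    have := mul_le_mul_of_nonneg_right hcon' ha.le
    linarith
  · rw [abs_le]
    constructor <;> linarith
  · rw [omega_pow, mul_left_comm _ (‖z‖ : ℂ), mul_left_comm _ (‖z‖ : ℂ), ← Complex.exp_add,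
      ← Complex.exp_add]
    conv_lhs => rw [hz]
    congr 2
    push_cast
    ring

lemma expI_mul_re (x : ℝ) (w : ℂ) :
    (exp (x * I) * w).re = Real.cos x * w.re - Real.sin x * w.im := by
  rw [Complex.mul_re, Complex.exp_ofReal_mul_I_re, Complex.exp_ofReal_mul_I_im]

lemma expI_mul_im (x : ℝ) (w : ℂ) :
    (exp (x * I) * w).im = Real.cos x * w.im + Real.sin x * w.re := by
  rw [Complex.mul_im, Complex.exp_ofReal_mul_I_re, Complex.exp_ofReal_mul_I_im]

lemma expI_mul_mem_D_iff (hp : 3 ≤ p) (m : ℕ) (w : ℂ) :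
    exp ((Real.pi / p : ℝ) * I) * w ∈ D p τ m ↔ w ∈ axialRect p τ m := by
  have hs := sin_pi_div_pos hp
  have hsc := Real.sin_sq_add_cos_sq (Real.pi / p)
  have hcexp : exp ((2 * (0 : ℕ) + 1) * I * Real.pi / p) = exp ((Real.pi / p : ℝ) * I) := by
    congr 1
    push_cast
    ring
  have hQ : exp ((Real.pi / p : ℝ) * I) * w ∈ Q p τ 0 ↔ 0 < w.re ∧ |w.im| < τ := by
    rw [Q, hcexp]
    constructor
    · rintro ⟨v, hv, hvw⟩
      have e : v = w := mul_left_cancel₀ (Complex.exp_ne_zero _) ((mul_comm _ _).trans hvw)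
      rwa [← e]
    · exact fun h => ⟨w, h, mul_comm _ _⟩
  -- Hence `C_m` is the vertical line `Re w = mπ / s`.
  have key : (exp ((Real.pi / p : ℝ) * I) * w).im +
      Real.cot (Real.pi / p) * (exp ((Real.pi / p : ℝ) * I) * w).re =
        w.re / Real.sin (Real.pi / p) := by
    rw [expI_mul_re, expI_mul_im, Real.cot_eq_cos_div_sin]
    field_simp
    linear_combination w.re * hsc
  have hlow : ∀ c : ℝ, (-Real.cot (Real.pi / p) * (exp ((Real.pi / p : ℝ) * I) * w).re +
      c / Real.sin (Real.pi / p) ^ 2 < (exp ((Real.pi / p : ℝ) * I) * w).im ↔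
      c / Real.sin (Real.pi / p) < w.re) := by
    intro c
    rw [← div_lt_div_iff_of_pos_right hs (b := w.re), ← key, div_div, ← sq]
    constructor <;> intro h <;> linarith
  have hupp : ∀ c : ℝ, ((exp ((Real.pi / p : ℝ) * I) * w).im <
      -Real.cot (Real.pi / p) * (exp ((Real.pi / p : ℝ) * I) * w).re +
      c / Real.sin (Real.pi / p) ^ 2 ↔ w.re < c / Real.sin (Real.pi / p)) := by
    intro c
    rw [← div_lt_div_iff_of_pos_right hs (a := w.re), ← key, div_div, ← sq]
    constructor <;> intro h <;> linarith
  rw [D, Set.mem_ofPred_eq, hQ, hlow, hupp, axialRect, Set.mem_ofPred_eq]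
  constructor
  · exact fun h => ⟨h.2.1, h.2.2, h.1.2⟩
  · refine fun h => ⟨⟨lt_of_le_of_lt ?_ h.1, h.2.2⟩, h.1, h.2.1⟩
    have := Real.pi_pos
    positivity

lemma mem_rotate_D_iff (hp : 3 ≤ p) (m k : ℕ) (z : ℂ) :
    z ∈ rotate p k (D p τ m) ↔
      ∃ w ∈ axialRect p τ m, z = omega p ^ k * (exp ((Real.pi / p : ℝ) * I) * w) := by
  constructor
  · rintro ⟨y, hy, rfl⟩
    have e : y = exp ((Real.pi / p : ℝ) * I) * (y / exp ((Real.pi / p : ℝ) * I)) :=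
      (mul_div_cancel₀ _ (Complex.exp_ne_zero _)).symm
    rw [e, expI_mul_mem_D_iff hp] at hy
    exact ⟨_, hy, by rw [← e]⟩
  · rintro ⟨w, hw, rfl⟩
    exact ⟨_, (expI_mul_mem_D_iff hp m w).2 hw, rfl⟩

lemma expI_mul_mem_V (hp : 3 ≤ p) (k : ℕ) {w : ℂ} (h0 : 0 < w.re) (h1 : w.im = 0) :
    omega p ^ k * (exp ((Real.pi / p : ℝ) * I) * w) ∈ V p k := by
  have hc := cos_pi_div_pos hp
  refine ⟨_, ⟨?_, ?_⟩, rfl⟩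
  · rw [expI_mul_re, expI_mul_im, h1, Real.tan_eq_sin_div_cos]
    field_simp
    ring
  · rw [expI_mul_re, h1, mul_zero, sub_zero]
    exact mul_pos hc h0

lemma norm_rotated (k : ℕ) (w : ℂ) :
    ‖omega p ^ k * (exp ((Real.pi / p : ℝ) * I) * w)‖ = ‖w‖ := by
  rw [norm_mul, norm_omega_pow, norm_mul, Complex.norm_exp_ofReal_mul_I, one_mul, one_mul]

lemma tendsto_natCast_mul_exp {c : ℝ} (hc : 0 < c) (b : ℝ) :
    Filter.Tendsto (fun x : ℝ => p * Real.exp (b - c * x)) Filter.atTop (nhds 0) := by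
  have h1 : Filter.Tendsto (fun x : ℝ => b - c * x) Filter.atTop Filter.atBot :=
    Filter.tendsto_atBot_add_const_left _ b
      (Filter.tendsto_neg_atTop_atBot.comp (Filter.tendsto_id.const_mul_atTop hc))
  simpa using (Real.tendsto_exp_atBot.comp h1).const_mul (p : ℝ)

end ExpSum

theorem mainTheorem5 (p : ℕ) (hp : 3 ≤ p) (τ : ℝ) (hτ : 0 < τ) :
    ∃ M : ℕ,
      (∀ m : ℕ, M < m → ∀ k : ℕ, k < p →
        (∃! z : ℂ, z ∈ ExpSum.rotate p k (ExpSum.D p τ m) ∧ ExpSum.f p z = 0) ∧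
        (∀ z ∈ ExpSum.rotate p k (ExpSum.D p τ m), ExpSum.f p z = 0 → z ∈ ExpSum.V p k)) ∧
      (∀ z : ℂ, ExpSum.f p z = 0 →
        ((M + 1) * Real.pi / Real.sin (Real.pi / p) < ‖z‖ ↔
          ∃ m : ℕ, M < m ∧ ∃ k : ℕ, k < p ∧ z ∈ ExpSum.rotate p k (ExpSum.D p τ m))) := by
  have hs := ExpSum.sin_pi_div_pos hp
  have hs2 : 0 < 2 * Real.sin (Real.pi / p) ^ 2 := by positivity
  obtain ⟨S, hε, hS⟩ := (((ExpSum.tendsto_natCast_mul_exp (p := p) hs2 τ).eventually_le_const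
    (by positivity : 0 < Real.sin (Real.pi / p) / 8)).and (Filter.eventually_ge_atTop 0)).exists
  change ExpSum.tailBound p τ S ≤ _ at hε
  have hgap : 0 < 1 - Real.exp (-(2 * Real.sin (Real.pi / p) * τ)) := by
    rw [sub_pos, Real.exp_lt_one_iff, neg_lt_zero]
    positivity
  obtain ⟨R, hR⟩ := Filter.eventually_atTop.1
    ((ExpSum.tendsto_natCast_mul_exp (p := p) hs2 0).eventually_lt_const hgap)
  simp only [zero_sub] at hR
  -- Beyond radius `R` zeros lie in the strips; the extra `τ` gives `Re w ≥ S` there, as `Re w ≥ ‖w‖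
  -- - |Im w|`.
  obtain ⟨M, hM⟩ := exists_nat_ge ((max (S + τ) R) / (Real.pi / Real.sin (Real.pi / p)))
  rw [div_le_iff₀ (div_pos Real.pi_pos hs), ← mul_div_assoc] at hM
  obtain ⟨hMS, hMR⟩ := max_le_iff.1 hM
  have hmono : ∀ a b : ℝ, a ≤ b →
      a * Real.pi / Real.sin (Real.pi / p) ≤ b * Real.pi / Real.sin (Real.pi / p) :=
    fun a b hab => div_le_div_of_nonneg_right
      (mul_le_mul_of_nonneg_right hab Real.pi_pos.le) hs.le
  have hSm : ∀ m : ℕ, M < m → S ≤ m * Real.pi / Real.sin (Real.pi / p) := by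
    intro m hm
    linarith [hmono M m (by exact_mod_cast hm.le)]
  refine ⟨M, fun m hm k hk => ⟨?_, ?_⟩, fun z hz => ⟨fun hlt => ?_, ?_⟩⟩
  · obtain ⟨w, hw, hw0⟩ := ExpSum.exists_axialSum_eq_zero hp hτ hS hε (hSm m hm)
    refine ⟨_, ⟨(ExpSum.mem_rotate_D_iff hp m k _).2 ⟨w, hw, rfl⟩, ?_⟩, ?_⟩
    · rwa [ExpSum.f_eq_axialSum hp]
    · rintro z ⟨hzD, hz⟩
      obtain ⟨v, hv, rfl⟩ := (ExpSum.mem_rotate_D_iff hp m k _).1 hzD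
      rw [ExpSum.f_eq_axialSum hp] at hz
      rw [ExpSum.eq_of_axialSum_eq_zero hp hS hε hv hw ((hSm m hm).trans hv.1.le)
        ((hSm m hm).trans hw.1.le) hz hw0]
  · intro z hzD hz
    obtain ⟨v, hv, rfl⟩ := (ExpSum.mem_rotate_D_iff hp m k _).1 hzD
    rw [ExpSum.f_eq_axialSum hp] at hz
    have hSv := (hSm m hm).trans_lt hv.1
    exact ExpSum.expI_mul_mem_V hp k (hS.trans_lt hSv)
      (ExpSum.im_eq_zero_of_axialSum_eq_zero hp hS hε hv hSv.le hz)
  · obtain ⟨k, hk, φ, hφ, hzw⟩ := ExpSum.exists_rotation hp z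
    have hr : M * Real.pi / Real.sin (Real.pi / p) ≤ ‖z‖ :=
      (hmono M (M + 1) (by linarith)).trans hlt.le
    set w : ℂ := ‖z‖ * Complex.exp (φ * Complex.I) with hw
    rw [hzw, ExpSum.f_eq_axialSum hp] at hz
    have him : |w.im| < τ := by
      have := ExpSum.abs_im_lt_of_axialSum_eq_zero hp (norm_nonneg z) hφ hz
        (hR _ (hMR.trans hr))
      rwa [hw, Complex.im_ofReal_mul, Complex.exp_ofReal_mul_I_im]
    have hnorm : ‖w‖ = ‖z‖ := by
      rw [hw, norm_mul, Complex.norm_exp_ofReal_mul_I, mul_one, Complex.norm_real, norm_norm]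
    have hpi : Real.pi / p ≤ Real.pi / 2 := by linarith [ExpSum.pi_div_le hp, Real.pi_pos]
    have hre0 : 0 ≤ w.re := by
      rw [hw, Complex.re_ofReal_mul, Complex.exp_ofReal_mul_I_re]
      exact mul_nonneg (norm_nonneg _)
        (Real.cos_nonneg_of_mem_Icc (abs_le.1 (hφ.trans hpi)))
    have hre : S ≤ w.re := by
      have := Complex.norm_le_abs_re_add_abs_im w
      rw [abs_of_nonneg hre0] at this
      linarith
    obtain ⟨m, hm⟩ := ExpSum.exists_mem_axialRect hp hS hε hre him hz
    refine ⟨m, ?_, k, hk, (ExpSum.mem_rotate_D_iff hp m k z).2 ⟨w, hm, hzw⟩⟩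
    have him0 := ExpSum.im_eq_zero_of_axialSum_eq_zero hp hS hε hm hre hz
    have hrez : w.re = ‖z‖ := by
      have := Complex.norm_le_abs_re_add_abs_im w
      rw [him0, abs_zero, add_zero, abs_of_nonneg hre0, hnorm] at this
      exact le_antisymm ((Complex.re_le_norm w).trans hnorm.le) this
    -- The zero is real in `w`, so `‖z‖ = Re w < (m+1)π / s`; `m ≤ M` would contradict the
    -- threshold.
    by_contra! hcon
    have h1 := hmono (m + 1) (M + 1) (by exact_mod_cast Nat.succ_le_succ hcon)
    linarith [hm.2.1]
  · rintro ⟨m, hm, k, hk, hzD⟩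
    obtain ⟨w, hw, rfl⟩ := (ExpSum.mem_rotate_D_iff hp m k _).1 hzD
    rw [ExpSum.norm_rotated]
    have h1 := hmono (M + 1) m (by exact_mod_cast hm)
    exact h1.trans_lt (hw.1.trans_le (Complex.re_le_norm w))
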